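/- Let $E$ be a Polish space with its Borel $\sigma$-algebra and let $\lambda$ be a Radon (locally finite Borel) measure on $E$. Let $\mathcal X$ be the space of configurations, i.e. of subsets $\xi\subset E$ with $|\xi\cap K|<\infty$ for every compact $K$, with the $\sigma$-algebra generated by the counting maps $\xi\mapsto\xi(B)=|\xi\cap B|$, $B$ Borel (for locally compact $E$ this is the Borel $\sigma$-algebra of the vague topology). Let $\mu$ be a point process on $E$, i.e. a probability measure on $\mathcal X$; it is simple, since $\xi(\{x\})\le 1$ for all $\xi\in\mathcal X$ and $x\in E$. Write $\mathbb E$ for expectation under $\mu$, $\lambda_k=\lambda^{\otimes k}$, and $\int v\,d\xi=\sum_{x\in\xi}v(x)$. Let $\rho_k:E^k\to[0,\infty)$, $k\ge 0$, be symmetric measurable functions such that, for every $k$, $\rho_k=0$ $\lambda_k$-almost everywhere on the set of tuples $(x_1,\dots,x_k)$ with two equal coordinates (automatic if $\lambda$ has no atoms). We say that $\mu$ has correlation functions $(\rho_k)$ with respect to $\lambda$ if, for every $n\ge 0$ and all pairwise disjoint bounded (i.e. relatively compact) Borel sets $A_1,\dots,A_n\subset E$, $$\mathbb E\Big[\prod_{i=1}^n\xi(A_i)\Big]=\int_{A_1\times\dots\times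 A_n}\rho_n(x)\,\lambda_n(dx).$$ **Proposition 3.6.** The process $\mu$ has correlation functions $(\rho_k)$ with respect to $\lambda$ if and only if, for every $n\ge 0$ and all measurable $v_1,\dots,v_n:E\to[0,\infty)$, $$\mathbb E\Big[\prod_{i=1}^n\int v_i\,d\xi\Big]=\sum_{\{P_1,\dots,P_k\}}\int_{E^k}\Big(\prod_{l=1}^k\prod_{i\in P_l}v_i(x_l)\Big)\rho_k(x_1,\dots,x_k)\,\lambda_k(dx),\qquad(*)$$ where the sum is over all partitions $\{P_1,\dots,P_k\}$ of $\{1,\dots,n\}$ into non-empty blocks. (Both sides may be $+\infty$, and $0\cdot\infty=0$. For $n=0$ both conditions just say $\rho_0=1$; for $n\ge 1$ one has $1\le k\le n$.) Moreover, suppose that $\lambda$ has no atoms, and consider the following alternative definition of correlation functions: there is a measurable function $\rho$ on the set $\mathcal X_0$ of finite configurations (with the trace $\sigma$-algebra), $\rho:\mathcal X_0\to[0,\infty)$, with $\rho(\{x_1,\dots,x_n\})=\rho_n(x_1,\dots,x_n)$ for all $n\ge0$ and all pairwise distinct $x_1,\dots,x_n$, such that for all measurable $f:\mathcal X_0\to[0,\infty)$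 $$\mathbb E\Big[\sum_{\alpha\subset\xi,\ \alpha\in\mathcal X_0}f(\alpha)\Big]=\sum_{n\ge 0}\frac1{n!}\int_{E^n}f(\{x_1,\dots,x_n\})\,\rho(\{x_1,\dots,x_n\})\,\lambda_n(dx).\qquad(**)$$ If $(\rho_k)$ are correlation functions of $\mu$ in this sense, then $(*)$ holds for all $n$ and all $v_1,\dots,v_n$. Conversely, if $(*)$ holds for all $n$ and all $v_1,\dots,v_n$, and $\mathbb E[\xi(K)^n]<\infty$ for every compact $K\subset E$ and every $n$, then $(\rho_k)$ are correlation functions of $\mu$ in this sense. -/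

import Mathlib

open MeasureTheory
open scoped ENNReal NNReal

/-- A configuration on `E`: a locally finite subset of `E`, i.e. a subset having finite
intersection with every compact set. -/
structure Configuration (E : Type*) [TopologicalSpace E] where
  carrier : Set E
  finite_inter : ∀ K : Set E, IsCompact K → (carrier ∩ K).Finite

namespace Configuration

variable {E : Type*} [TopologicalSpace E]

/-- The number `ξ(B)` of points of the configuration `ξ` in the set `B`. -/
noncomputable def count (ξ : Configuration E) (B : Set E) : ℕ∞ :=
  (ξ.carrier ∩ B).encard

/-- A configuration has at most one particle at each site: configurations are simple. -/
theorem count_singleton_le_one (ξ : Configuration E) (x : E) : ξ.count {x} ≤ 1 := by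
  unfold count
  exact (Set.encard_le_encard Set.inter_subset_right).trans_eq (Set.encard_singleton x)

/-- The integral `∫ v dξ = ∑_{x ∈ ξ} v(x)` of a nonnegative function against a configuration. -/
noncomputable def integral (ξ : Configuration E) (v : E → ℝ≥0) : ℝ≥0∞ :=
  ∑' x : ξ.carrier, (v x : ℝ≥0∞)

/-- The σ-algebra on the configuration space: the smallest one for which all counting maps
`ξ ↦ ξ(B)`, with `B` a Borel set, are measurable. (When `E` is locally compact, this is the Borel
σ-algebra of the vague topology.) -/
noncomputable instance [MeasurableSpace E] : MeasurableSpace (Configuration E) :=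
  ⨆ (B : Set E) (_ : MeasurableSet B),
    MeasurableSpace.comap (fun ξ : Configuration E => ξ.count B) ⊤

end Configuration

/-- The space of finite configurations, with the trace σ-algebra. -/
abbrev FiniteConfiguration (E : Type*) [TopologicalSpace E] : Type _ :=
  {α : Configuration E // α.carrier.Finite}

/-- The finite configuration `{x_1, …, x_n}`. -/
def FiniteConfiguration.ofTuple {E : Type*} [TopologicalSpace E] {n : ℕ} (x : Fin n → E) :
    FiniteConfiguration E :=
  ⟨⟨Set.range x, fun _ _ => (Set.finite_range x).inter_of_left _⟩, Set.finite_range x⟩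

section

variable {E : Type*} [TopologicalSpace E] [MeasurableSpace E]

/-- The integral `∫ f dL` of a nonnegative function on finite configurations against the
`lam`-sample measure `L`, namely `∑_{n ≥ 0} (1/n!) ∫_{E^n} f({x_1, …, x_n}) lam(dx_1) … lam(dx_n)`. -/
noncomputable def sampleIntegral (lam : Measure E) (f : FiniteConfiguration E → ℝ≥0) : ℝ≥0∞ :=
  ∑' n : ℕ, ((n.factorial : ℝ≥0∞))⁻¹ *
    ∫⁻ x : Fin n → E, (f (FiniteConfiguration.ofTuple x) : ℝ≥0∞) ∂(Measure.pi fun _ => lam)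

/-- `r` is a correlation function, on finite configurations, of the point process `μ`:
`r` is measurable and `E[∑_{α ⊆ ξ, α finite} f(α)] = ∫ f r dL` for all measurable `f ≥ 0`. -/
def HasCorrelationFunction (μ : Measure (Configuration E)) (lam : Measure E)
    (r : FiniteConfiguration E → ℝ≥0) : Prop :=
  Measurable r ∧ ∀ f : FiniteConfiguration E → ℝ≥0, Measurable f →
    ∫⁻ ξ, ∑' α : {α : FiniteConfiguration E // α.1.carrier ⊆ ξ.carrier}, (f α.1 : ℝ≥0∞) ∂μ =
      sampleIntegral lam (fun α => f α * r α)

/-- The family `(ρ_n)` comes from a correlation function `r` on finite configurations, i.e.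
`r({x_1, …, x_n}) = ρ_n(x_1, …, x_n)` for pairwise distinct `x_1, …, x_n`. -/
def HasSampleCorrelationFunctions (μ : Measure (Configuration E)) (lam : Measure E)
    (ρ : (n : ℕ) → (Fin n → E) → ℝ≥0) : Prop :=
  ∃ r : FiniteConfiguration E → ℝ≥0, HasCorrelationFunction μ lam r ∧
    ∀ (n : ℕ) (x : Fin n → E), Function.Injective x →
      r (FiniteConfiguration.ofTuple x) = ρ n x

/-- `μ` has correlation functions `(ρ_n)` with respect to `lam`: for all pairwise disjoint bounded
(that is, relatively compact) Borel sets `A_1, …, A_n`,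
`E[∏ ξ(A_i)] = ∫_{A_1 × … × A_n} ρ_n d lam^n`. For `n = 0` this is the normalization `ρ_0 = 1`. -/
def HasCorrelationFunctions (μ : Measure (Configuration E)) (lam : Measure E)
    (ρ : (n : ℕ) → (Fin n → E) → ℝ≥0) : Prop :=
  ∀ (n : ℕ) (A : Fin n → Set E), (∀ i, MeasurableSet (A i)) → (∀ i, IsCompact (closure (A i))) →
    Pairwise (fun i j => Disjoint (A i) (A j)) →
    ∫⁻ ξ, ∏ i, ((ξ.count (A i) : ℕ∞) : ℝ≥0∞) ∂μ =
      ∫⁻ x in Set.univ.pi A, (ρ n x : ℝ≥0∞) ∂(Measure.pi fun _ => lam)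

/-- The moment formula: for all `n` and all measurable nonnegative `v_1, …, v_n`, the expectation
`E[∏ ∫ v_i dξ]` is the sum, over all partitions `{P_1, …, P_k}` of the index set, of
`∫_{E^k} (∏_l ∏_{i ∈ P_l} v_i(x_l)) ρ_k(x_1, …, x_k) lam(dx_1) … lam(dx_k)`. The blocks are numbered
by an arbitrary enumeration, which is immaterial since the `ρ_k` are symmetric. For `n = 0` the
only partition is the empty one, and the formula is the normalization `ρ_0 = 1`. -/
def MomentFormula (μ : Measure (Configuration E)) (lam : Measure E)
    (ρ : (n : ℕ) → (Fin n → E) → ℝ≥0) : Prop :=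
  ∀ (n : ℕ) (v : Fin n → E → ℝ≥0), (∀ i, Measurable (v i)) →
    ∫⁻ ξ, ∏ i, Configuration.integral ξ (v i) ∂μ =
      ∑ P : Finpartition (Finset.univ : Finset (Fin n)),
        ∫⁻ x : Fin P.parts.card → E,
          (((∏ l, ∏ i ∈ (P.parts.equivFin.symm l).1, v i (x l)) * ρ P.parts.card x : ℝ≥0) : ℝ≥0∞)
          ∂(Measure.pi fun _ => lam)

end

/-! ### Measurable enumeration of the points, and factorial moment measures. -/

section Enumeration

open Set Filter TopologicalSpace Function

variable {E : Type*} [TopologicalSpace E]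

/-! Everything is a comparison of two measures on `E^k`: `factorialMoment μ k`, the mean counting
measure of injective `k`-tuples of points, and `densityMeasure lam ρ k`, with density `ρ k`. A
product of integrals over `ξ` is a sum over all `n`-tuples of points. Sorting them by which
coordinates coincide shows that (*), with factorial moment measures in place of densities, holds for
every process (`lintegral_prod_integral`). So (*) says that the two families give equal partition
sums.

For indicators of disjoint sets only the discrete partition survives (`sum_lintegral_indicator_eq`),
so having correlation functions means agreement on bounded boxes with disjoint sides, and (*)
implies it. Conversely, both measures live on injective tuples in a σ-compact set, so such boxes
exhaust every box (`measure_pi_eq_of_disjoint`). Agreement passes from boxes to product functions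
one coordinate at a time (`lintegral_prod_eq_of_measure_pi_eq`), which gives (*) termwise even for
infinite moments.

The sample definition is equality of the two measures, tested on all sets. Agreement on boxes yields
this once the moments are finite, by a π-system argument. -/

namespace Configuration

/-- The injective `k`-tuples of points of a configuration. -/
def tuples (ξ : Configuration E) (k : ℕ) : Set (Fin k → E) :=
  {x | Injective x ∧ ∀ i, x i ∈ ξ.carrier}

/-- A sequence of other points of `ξ` converging to `x` would, with its limit, form a compact set.
This meets `ξ` in a finite, hence closed, set, which forces `x` to be one of the other points. -/
theorem exists_isolating [MetrizableSpace E] {b : Set (Set E)} (hb : IsTopologicalBasis b)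
    (ξ : Configuration E) {x : E} (hx : x ∈ ξ.carrier) :
    ∃ U ∈ b, ξ.carrier ∩ U = {x} := by
  let _ := metrizableSpaceMetric E
  have hcl : x ∉ closure (ξ.carrier \ {x}) := by
    intro h
    obtain ⟨y, hy, hlim⟩ := mem_closure_iff_seq_limit.1 h
    have hfin := ξ.finite_inter _ hlim.isCompact_insert_range
    have hcl := (hfin.subset (sdiff_subset (t := {x}))).isClosed
    have := hcl.mem_of_tendsto hlim (Eventually.of_forall fun n =>
      ⟨⟨(hy n).1, Or.inr (mem_range_self n)⟩, (hy n).2⟩)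
    exact this.2 rfl
  obtain ⟨U, hU, hxU, hsub⟩ := hb.exists_subset_of_mem_open
    (show x ∈ (closure (ξ.carrier \ {x}))ᶜ from hcl) isClosed_closure.isOpen_compl
  refine ⟨U, hU, ?_⟩
  ext y
  constructor
  · rintro ⟨hy, hyU⟩
    by_contra hne
    exact hsub hyU (subset_closure ⟨hy, hne⟩)
  · rintro rfl
    exact ⟨hx, hxU⟩

variable [MeasurableSpace E]

theorem measurableSet_count {B : Set E} (hB : MeasurableSet B) (s : Set ℕ∞) :
    MeasurableSet {ξ : Configuration E | ξ.count B ∈ s} := by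
  have : MeasurableSpace.comap (fun ξ : Configuration E => ξ.count B) ⊤ ≤
      (inferInstance : MeasurableSpace (Configuration E)) :=
    le_iSup₂_of_le B hB le_rfl
  exact this _ ⟨s, trivial, rfl⟩

/-- The counting measure on the injective tuples of points of a configuration. -/
noncomputable def tupleMeasure (k : ℕ) (ξ : Configuration E) : Measure (Fin k → E) :=
  Measure.sum fun x : ξ.tuples k => Measure.dirac x.1

theorem lintegral_tupleMeasure {k : ℕ} (ξ : Configuration E) {g : (Fin k → E) → ℝ≥0∞}
    (hg : Measurable g) : ∫⁻ x, g x ∂(ξ.tupleMeasure k) = ∑' x : ξ.tuples k, g x := by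
  rw [tupleMeasure, lintegral_sum_measure]
  exact tsum_congr fun x => lintegral_dirac' _ hg

variable [PolishSpace E] [BorelSpace E]

/-- The points of a configuration can be enumerated measurably. -/
theorem exists_measurable_enumeration [Nonempty E] :
    ∃ (D : ℕ → Set (Configuration E)) (p : ℕ → Configuration E → E),
      (∀ j, MeasurableSet (D j)) ∧ (∀ j, Measurable (p j)) ∧
      ∀ ξ : Configuration E, BijOn (fun j => p j ξ) {j | ξ ∈ D j} ξ.carrier := by
  classical
  have hb := isBasis_countableBasis E
  have hne : (countableBasis E).Nonempty := by
    by_contra h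
    have hU := hb.sUnion_eq
    rw [not_nonempty_iff_eq_empty.1 h, sUnion_empty] at hU
    exact empty_ne_univ hU
  obtain ⟨U, hU⟩ := (countable_countableBasis E).exists_eq_range hne
  have hUo : ∀ j, MeasurableSet (U j) := fun j =>
    (hb.isOpen (hU ▸ mem_range_self j)).measurableSet
  let D : ℕ → Set (Configuration E) := fun j =>
    {ξ | ξ.count (U j) ∈ ({1} : Set ℕ∞)} ∩
      ⋂ i, ⋂ (_ : i < j), ({ξ | ξ.count (U i) ∈ ({1}ᶜ : Set ℕ∞)} ∪
        {ξ | ξ.count (U i ∩ U j) ∈ ({0} : Set ℕ∞)})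
  have hD : ∀ j, MeasurableSet (D j) := fun j =>
    (measurableSet_count (hUo j) _).inter <| MeasurableSet.iInter fun i =>
      MeasurableSet.iInter fun _ => (measurableSet_count (hUo i) _).union
        (measurableSet_count ((hUo i).inter (hUo j)) _)
  have hpt : ∀ j ξ, ∃ x, ξ ∈ D j → ξ.carrier ∩ U j = {x} := by
    intro j ξ
    by_cases h : ξ ∈ D j
    · obtain ⟨x, hx⟩ := encard_eq_one.1 h.1
      exact ⟨x, fun _ => hx⟩
    · exact ⟨Classical.arbitrary E, fun h' => absurd h' h⟩
  choose q hq using hpt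
  let p : ℕ → Configuration E → E := fun j ξ => if ξ ∈ D j then q j ξ else Classical.arbitrary E
  have hp : ∀ {j ξ}, ξ ∈ D j → ξ.carrier ∩ U j = {p j ξ} := fun {j ξ} h => by
    simp only [p, if_pos h, hq j ξ h]
  refine ⟨D, p, hD, fun j => ?_, fun ξ => ⟨fun j hj => ?_, ?_, ?_⟩⟩
  · intro B hB
    -- Where `U j` isolates a point, that point lies in `B` exactly when `U j ∩ B` still has one
    -- point. Elsewhere `p j` is the constant default value.
    have : p j ⁻¹' B = (D j ∩ {ξ | ξ.count (U j ∩ B) ∈ ({1} : Set ℕ∞)}) ∪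
        ((D j)ᶜ ∩ {_ξ | Classical.arbitrary E ∈ B}) := by
      ext ξ
      by_cases h : ξ ∈ D j
      · have hpq := hp h
        simp only [mem_preimage, mem_union, mem_inter_iff, h, true_and, mem_compl_iff,
          not_true_eq_false, false_and, or_false, mem_ofPred_eq, mem_singleton_iff, count,
          ← inter_assoc, hpq]
        by_cases hB : p j ξ ∈ B
        · simp [hB]
        · simp [hB]
      · simp [h, p]
    rw [this]
    exact ((hD j).inter (measurableSet_count ((hUo j).inter hB) _)).union
      ((hD j).compl.inter (MeasurableSet.const _))
  · exact (inter_subset_left : ξ.carrier ∩ U j ⊆ _) (hp hj ▸ mem_singleton _)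
  · have key : ∀ i j, ξ ∈ D i → ξ ∈ D j → p i ξ = p j ξ → ¬ i < j := by
      intro i j hi hj hij hlt
      have h := mem_iInter₂.1 hj.2 i hlt
      rcases h with h | h
      · exact h hi.1
      · have h1 : p i ξ ∈ ξ.carrier ∩ U i := hp hi ▸ mem_singleton _
        have h2 : p j ξ ∈ ξ.carrier ∩ U j := hp hj ▸ mem_singleton _
        have : p i ξ ∈ ξ.carrier ∩ (U i ∩ U j) := ⟨h1.1, h1.2, hij ▸ h2.2⟩
        rw [encard_eq_zero.1 h] at this
        exact this
    intro i hi j hj hij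
    rcases lt_trichotomy i j with h | h | h
    · exact absurd h (key i j hi hj hij)
    · exact h
    · exact absurd h (key j i hj hi hij.symm)
  · intro x hx
    have hex : ∃ j, ξ.carrier ∩ U j = {x} := by
      obtain ⟨V, hV, hx⟩ := exists_isolating hb ξ hx
      rw [hU] at hV
      obtain ⟨j, rfl⟩ := hV
      exact ⟨j, hx⟩
    have hspec := Nat.find_spec hex
    have hmem : ξ ∈ D (Nat.find hex) := by
      refine ⟨by simp [count, hspec], mem_iInter₂.2 fun i hi => ?_⟩
      by_cases h1 : ξ.count (U i) = 1
      · right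
        obtain ⟨y, hy⟩ := encard_eq_one.1 h1
        refine encard_eq_zero.2 (eq_empty_of_forall_notMem fun z hz => ?_)
        have hzx : z ∈ ξ.carrier ∩ U (Nat.find hex) := ⟨hz.1, hz.2.2⟩
        have hzy : z ∈ ξ.carrier ∩ U i := ⟨hz.1, hz.2.1⟩
        rw [hspec, mem_singleton_iff] at hzx
        have hzy' := hzy
        rw [hy, mem_singleton_iff] at hzy'
        subst hzx
        exact Nat.find_min hex hi (by rw [hy, hzy'])
      · exact Or.inl h1
    exact ⟨_, hmem, by
      have h := hp hmem
      rw [hspec] at h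
      exact (singleton_eq_singleton_iff.1 h).symm⟩

/-- The enumeration turns a sum over a set depending on `ξ` into a sum of measurable terms over the
fixed countable set `ℕ^k`. -/
theorem measurable_tsum_tuples {k : ℕ} {g : (Fin k → E) → ℝ≥0∞} (hg : Measurable g) :
    Measurable fun ξ : Configuration E => ∑' x : ξ.tuples k, g x := by
  classical
  rcases isEmpty_or_nonempty E with hE | hE
  · have : Subsingleton (Configuration E) :=
      ⟨fun ⟨s, _⟩ ⟨t, _⟩ => by congr; exact Subsingleton.elim _ _⟩
    exact Subsingleton.measurable
  obtain ⟨D, p, hD, hp, hbij⟩ := exists_measurable_enumeration (E := E)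
  have key : ∀ ξ : Configuration E, ∑' x : ξ.tuples k, g x =
      ∑' j : Fin k → ℕ, {ξ | Injective j ∧ ∀ i, ξ ∈ D (j i)}.indicator
        (fun ξ => g fun i => p (j i) ξ) ξ := by
    intro ξ
    have hB : BijOn (fun (j : Fin k → ℕ) i => p (j i) ξ)
        {j | Injective j ∧ ∀ i, ξ ∈ D (j i)} (ξ.tuples k) := by
      refine ⟨fun j hj => ⟨fun a b hab => hj.1 ((hbij ξ).injOn (hj.2 a) (hj.2 b) hab),
        fun i => (hbij ξ).mapsTo (hj.2 i)⟩, fun j hj j' hj' h => ?_, fun x hx => ?_⟩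
      · exact funext fun i => (hbij ξ).injOn (hj.2 i) (hj'.2 i) (congrFun h i)
      · choose j hj hjx using fun i => (hbij ξ).surjOn (hx.2 i)
        refine ⟨j, ⟨fun a b hab => hx.1 ?_, hj⟩, funext hjx⟩
        rw [← hjx a, ← hjx b, hab]
    rw [← (hB.equiv _).tsum_eq]
    have : ∀ j : {j : Fin k → ℕ | Injective j ∧ ∀ i, ξ ∈ D (j i)},
        g (hB.equiv _ j) = (fun j : Fin k → ℕ => g fun i => p (j i) ξ) j := fun j => rfl
    simp_rw [this]
    rw [tsum_subtype {j : Fin k → ℕ | Injective j ∧ ∀ i, ξ ∈ D (j i)}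
      (fun j : Fin k → ℕ => g fun i => p (j i) ξ)]
    rfl
  simp_rw [key]
  refine Measurable.tsum fun j => Measurable.indicator ?_ ?_
  · exact hg.comp (measurable_pi_lambda _ fun i => hp (j i))
  · exact (MeasurableSet.const (Injective j)).inter
      (MeasurableSet.iInter (fun i => hD (j i)) |>.congr (by ext; exact mem_iInter))

theorem measurable_tupleMeasure (k : ℕ) :
    Measurable (tupleMeasure k : Configuration E → Measure (Fin k → E)) := by
  refine Measure.measurable_of_measurable_coe _ fun B hB => ?_
  have : ∀ ξ : Configuration E, ξ.tupleMeasure k B = ∑' x : ξ.tuples k, B.indicator 1 x.1 := by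
    intro ξ
    rw [← lintegral_tupleMeasure ξ (measurable_one.indicator hB), lintegral_indicator_one hB]
  simp_rw [this]
  exact measurable_tsum_tuples (measurable_one.indicator hB)

end Configuration

/-- The `k`-th factorial moment measure of a point process. -/
noncomputable def factorialMoment [MeasurableSpace E] (μ : Measure (Configuration E)) (k : ℕ) :
    Measure (Fin k → E) :=
  μ.bind (Configuration.tupleMeasure k)

variable [MeasurableSpace E] [PolishSpace E] [BorelSpace E]

theorem lintegral_factorialMoment (μ : Measure (Configuration E)) {k : ℕ}
    {g : (Fin k → E) → ℝ≥0∞} (hg : Measurable g) :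
    ∫⁻ x, g x ∂(factorialMoment μ k) = ∫⁻ ξ, ∑' x : ξ.tuples k, g x ∂μ := by
  rw [factorialMoment, Measure.lintegral_bind (Configuration.measurable_tupleMeasure k).aemeasurable
    hg.aemeasurable]
  simp_rw [Configuration.lintegral_tupleMeasure _ hg]

end Enumeration

/-! ### Expansion of products of integrals over set partitions. -/

section Combinatorics

open Set Function

theorem ENNReal.prod_tsum_eq_tsum_pi {α : Type*} {n : ℕ} (f : Fin n → α → ℝ≥0∞) :
    ∏ i, ∑' a, f i a = ∑' x : Fin n → α, ∏ i, f i (x i) := by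
  induction n with
  | zero => simp
  | succ n ih =>
    rw [← (Fin.consEquiv fun _ => α).tsum_eq, ENNReal.tsum_prod', Fin.prod_univ_succ, ih,
      ← ENNReal.tsum_mul_right]
    refine tsum_congr fun a => ?_
    rw [← ENNReal.tsum_mul_left]
    refine tsum_congr fun x => ?_
    simp [Fin.prod_univ_succ, Fin.consEquiv]

namespace Finpartition

variable {n : ℕ} (P : Finpartition (Finset.univ : Finset (Fin n)))

/-- The number of the block containing a given index. -/
noncomputable def blockIndex (i : Fin n) : Fin P.parts.card :=
  P.parts.equivFin ⟨P.part i, P.part_mem.2 (Finset.mem_univ i)⟩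

theorem blockIndex_eq_iff {i : Fin n} {l : Fin P.parts.card} :
    P.blockIndex i = l ↔ i ∈ (P.parts.equivFin.symm l).1 := by
  rw [blockIndex, ← Equiv.eq_symm_apply, Subtype.ext_iff]
  exact P.part_eq_iff_mem (P.parts.equivFin.symm l).2

theorem blockIndex_eq_blockIndex_iff {i j : Fin n} :
    P.blockIndex i = P.blockIndex j ↔ i ∈ P.part j := by
  rw [blockIndex_eq_iff]
  simp [blockIndex]

theorem blockIndex_surjective : Surjective P.blockIndex := by
  intro l
  obtain ⟨i, hi⟩ := P.nonempty_of_mem_parts (P.parts.equivFin.symm l).2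
  exact ⟨i, P.blockIndex_eq_iff.2 hi⟩

theorem prod_parts_eq {M : Type*} [CommMonoid M] (f : Fin n → Fin P.parts.card → M) :
    ∏ l, ∏ i ∈ (P.parts.equivFin.symm l).1, f i l = ∏ i, f i (P.blockIndex i) := by
  classical
  rw [← Finset.prod_fiberwise Finset.univ P.blockIndex]
  refine Finset.prod_congr rfl fun l _ => ?_
  have : (P.parts.equivFin.symm l).1 = Finset.univ.filter fun i => P.blockIndex i = l := by
    ext i
    simp [blockIndex_eq_iff]
  rw [this]
  refine Finset.prod_congr rfl fun i hi => ?_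
  rw [(Finset.mem_filter.1 hi).2]

theorem eq_of_mem_part_iff {P Q : Finpartition (Finset.univ : Finset (Fin n))}
    (h : ∀ i j, i ∈ P.part j ↔ i ∈ Q.part j) : P = Q := by
  have hpart : ∀ j, P.part j = Q.part j := fun j => Finset.ext fun i => h i j
  have key : ∀ R : Finpartition (Finset.univ : Finset (Fin n)),
      R.parts = Finset.univ.image R.part := by
    intro R
    ext t
    simp only [Finset.mem_image, Finset.mem_univ, true_and]
    constructor
    · intro ht
      obtain ⟨i, hi⟩ := R.nonempty_of_mem_parts ht
      exact ⟨i, R.part_eq_of_mem ht hi⟩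
    · rintro ⟨i, rfl⟩
      exact R.part_mem.2 (Finset.mem_univ i)
  ext1
  rw [key P, key Q]
  exact Finset.image_congr fun j _ => hpart j

end Finpartition

namespace Configuration

variable {E : Type*} [TopologicalSpace E]

/-- A tuple of points determines the partition of its indices by equal values, and factors uniquely
through an injective tuple indexed by the blocks. -/
theorem bijective_tuples_comp_blockIndex (ξ : Configuration E) (n : ℕ) :
    Bijective fun z : Σ P : Finpartition (Finset.univ : Finset (Fin n)), ξ.tuples P.parts.card =>
      fun i => (⟨z.2.1 (z.1.blockIndex i), z.2.2.2 _⟩ : ξ.carrier) := by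
  classical
  constructor
  · rintro ⟨P, y, hy⟩ ⟨Q, z, hz⟩ h
    have h' : ∀ i, y (P.blockIndex i) = z (Q.blockIndex i) := fun i =>
      congrArg Subtype.val (congrFun h i)
    obtain rfl : P = Q := by
      refine Finpartition.eq_of_mem_part_iff fun i j => ?_
      rw [← P.blockIndex_eq_blockIndex_iff, ← Q.blockIndex_eq_blockIndex_iff, ← hy.1.eq_iff,
        ← hz.1.eq_iff, h', h']
    congr
    funext l
    obtain ⟨i, rfl⟩ := P.blockIndex_surjective l
    exact h' i
  · intro x
    let P := Finpartition.ofSetoid (Setoid.ker x)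
    have hP : ∀ i j, P.blockIndex i = P.blockIndex j ↔ x i = x j := fun i j => by
      rw [P.blockIndex_eq_blockIndex_iff, Finpartition.mem_part_ofSetoid_iff_rel]
      exact eq_comm
    choose s hs using P.blockIndex_surjective
    refine ⟨⟨P, fun l => x (s l), fun l m h => ?_, fun l => (x (s l)).2⟩, ?_⟩
    · rw [← hs l, ← hs m]
      exact (hP _ _).2 (Subtype.ext h)
    · funext i
      exact Subtype.ext (congrArg Subtype.val ((hP _ _).1 (hs _)))

theorem prod_integral_eq (ξ : Configuration E) {n : ℕ} (v : Fin n → E → ℝ≥0) :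
    ∏ i, ξ.integral (v i) = ∑ P : Finpartition (Finset.univ : Finset (Fin n)),
      ∑' y : ξ.tuples P.parts.card,
        ((∏ l, ∏ i ∈ (P.parts.equivFin.symm l).1, v i (y.1 l) : ℝ≥0) : ℝ≥0∞) := by
  simp only [integral]
  rw [ENNReal.prod_tsum_eq_tsum_pi fun i (a : ξ.carrier) => (v i a : ℝ≥0∞),
    ← (Equiv.ofBijective _ (ξ.bijective_tuples_comp_blockIndex n)).tsum_eq, ENNReal.tsum_sigma',
    tsum_fintype]
  refine Finset.sum_congr rfl fun P _ => tsum_congr fun y => ?_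
  rw [P.prod_parts_eq fun i l => v i (y.1 l)]
  simp

end Configuration

variable {E : Type*} [TopologicalSpace E] [MeasurableSpace E] [PolishSpace E] [BorelSpace E]

theorem lintegral_prod_integral (μ : Measure (Configuration E)) {n : ℕ} (v : Fin n → E → ℝ≥0)
    (hv : ∀ i, Measurable (v i)) :
    ∫⁻ ξ, ∏ i, Configuration.integral ξ (v i) ∂μ =
      ∑ P : Finpartition (Finset.univ : Finset (Fin n)), ∫⁻ x,
        ((∏ l, ∏ i ∈ (P.parts.equivFin.symm l).1, v i (x l) : ℝ≥0) : ℝ≥0∞)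
          ∂(factorialMoment μ P.parts.card) := by
  have hm : ∀ P : Finpartition (Finset.univ : Finset (Fin n)),
      Measurable fun x : Fin P.parts.card → E =>
        ((∏ l, ∏ i ∈ (P.parts.equivFin.symm l).1, v i (x l) : ℝ≥0) : ℝ≥0∞) := fun P =>
    (Finset.measurable_prod _ fun l _ => Finset.measurable_prod _ fun i _ =>
      (hv i).comp (measurable_pi_apply l)).coe_nnreal_ennreal
  simp_rw [Configuration.prod_integral_eq]
  rw [lintegral_finsetSum _ fun P _ => Configuration.measurable_tsum_tuples (hm P)]
  exact Finset.sum_congr rfl fun P _ => (lintegral_factorialMoment μ (hm P)).symm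

end Combinatorics

/-! ### From disjoint bounded boxes to all boxes and product functions. -/

section Boxes

open Set Function

/-- An s-finite measure is absolutely continuous with respect to a finite one, and finite Borel
measures on a Polish space are tight. -/
theorem exists_isSigmaCompact_measure_compl_eq_zero {E : Type*} [TopologicalSpace E]
    [PolishSpace E] [MeasurableSpace E] [BorelSpace E] (ν : Measure E) [SFinite ν] :
    ∃ S, IsSigmaCompact S ∧ ν Sᶜ = 0 := by
  have h : ∀ n : ℕ, ∃ K, IsCompact K ∧ ν.toFinite Kᶜ < ((n : ℝ≥0∞) + 1)⁻¹ := fun n => by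
    obtain ⟨K, hK, hlt⟩ := exists_isCompact_closure_measure_compl_lt ν.toFinite
      ((n : ℝ≥0∞) + 1)⁻¹ (by simp)
    exact ⟨closure K, hK, (measure_mono (compl_subset_compl.2 subset_closure)).trans_lt hlt⟩
  choose K hK hlt using h
  refine ⟨⋃ n, K n, isSigmaCompact_iUnion_of_isCompact _ hK,
    absolutelyContinuous_toFinite ν ?_⟩
  refine le_antisymm (ENNReal.le_of_forall_pos_le_add fun ε hε _ => ?_) (zero_le)
  obtain ⟨n, hn⟩ := ENNReal.exists_inv_nat_lt (ENNReal.coe_ne_zero.2 hε.ne')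
  calc ν.toFinite (⋃ n, K n)ᶜ ≤ ν.toFinite (K n)ᶜ :=
        measure_mono (compl_subset_compl.2 (subset_iUnion K n))
    _ ≤ ((n : ℝ≥0∞) + 1)⁻¹ := (hlt n).le
    _ ≤ (n : ℝ≥0∞)⁻¹ := ENNReal.inv_le_inv.2 le_self_add
    _ ≤ 0 + ε := by rw [zero_add]; exact hn.le

/-- A σ-compact set carries both a given σ-finite measure and almost every configuration. -/
theorem exists_compact_exhaustion {E : Type*} [TopologicalSpace E] [PolishSpace E]
    [MeasurableSpace E] [BorelSpace E] (lam : Measure E) [SFinite lam]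
    (μ : Measure (Configuration E)) [IsFiniteMeasure μ] :
    ∃ K : ℕ → Set E, (∀ n, IsCompact (K n)) ∧ Monotone K ∧ (∀ᵐ x ∂lam, x ∈ ⋃ n, K n) ∧
      ∀ᵐ ξ ∂μ, ξ.carrier ⊆ ⋃ n, K n := by
  rcases isEmpty_or_nonempty E with hE | hE
  · exact ⟨fun _ => ∅, fun _ => isCompact_empty, monotone_const, ae_of_all _ fun x => hE.elim x,
      ae_of_all _ fun ξ x => hE.elim x⟩
  obtain ⟨D, p, hD, hp, hbij⟩ := Configuration.exists_measurable_enumeration (E := E)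
  obtain ⟨S, ⟨K, hK, rfl⟩, hS⟩ := exists_isSigmaCompact_measure_compl_eq_zero
    -- One s-finite measure controls both `lam` and every enumerated point; restricting to `D j`
    -- discards the default values.
    (lam + Measure.sum fun j => (μ.restrict (D j)).map (p j))
  rw [Measure.add_apply, add_eq_zero, Measure.sum_apply _
    (MeasurableSet.iUnion fun n => (hK n).measurableSet).compl, ENNReal.tsum_eq_zero] at hS
  refine ⟨accumulate K, isCompact_accumulate hK, monotone_accumulate, ?_, ?_⟩
  · rw [iUnion_accumulate]
    exact hS.1
  · have h : ∀ᵐ ξ ∂μ, ∀ j, ξ ∈ D j → p j ξ ∈ ⋃ n, K n := by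
      refine ae_all_iff.2 fun j => (ae_restrict_iff' (hD j)).1 ?_
      have : ∀ᵐ x ∂(μ.restrict (D j)).map (p j), x ∈ ⋃ n, K n := hS.2 j
      exact ae_of_ae_map (hp j).aemeasurable this
    filter_upwards [h] with ξ hξ x hx
    rw [iUnion_accumulate]
    obtain ⟨j, hj, rfl⟩ := (hbij ξ).surjOn hx
    exact hξ j hj

/-- Measures carried by the injective tuples are determined on boxes by their values on boxes with
pairwise disjoint relatively compact sides. -/
theorem measure_pi_eq_of_disjoint {E : Type*} [TopologicalSpace E] [PolishSpace E]
    [MeasurableSpace E] [BorelSpace E] {k : ℕ} {α β : Measure (Fin k → E)} {K : ℕ → Set E}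
    (hK : ∀ n, IsCompact (K n)) (hmono : Monotone K)
    (hα : ∀ᵐ x ∂α, Injective x ∧ ∀ i, x i ∈ ⋃ n, K n)
    (hβ : ∀ᵐ x ∂β, Injective x ∧ ∀ i, x i ∈ ⋃ n, K n)
    (h : ∀ A : Fin k → Set E, (∀ i, MeasurableSet (A i)) → (∀ i, IsCompact (closure (A i))) →
      Pairwise (fun i j => Disjoint (A i) (A j)) → α (univ.pi A) = β (univ.pi A))
    (A : Fin k → Set E) (hA : ∀ i, MeasurableSet (A i)) : α (univ.pi A) = β (univ.pi A) := by
  classical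
  -- An injection into Cantor space; its first `m` bits cut `E` into finitely many measurable cells,
  -- and any two points are eventually separated.
  obtain ⟨e, he, hinj⟩ := MeasurableSpace.measurable_injection_nat_bool_of_countablySeparated E
  let π : (m : ℕ) → E → Fin m → Bool := fun m x i => e x i
  have hπ : ∀ m, Measurable (π m) := fun m =>
    measurable_pi_lambda _ fun i => (measurable_pi_apply _).comp he
  -- Tuples in the box, inside `K m`, with coordinates in distinct level-`m` cells: a finite
  -- disjoint union of boxes with disjoint bounded sides. As `m` grows they fill the box up to a
  -- null set.
  let G : ℕ → Set (Fin k → E) := fun m =>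
    {x | Injective (fun i => π m (x i)) ∧ ∀ i, x i ∈ A i ∩ K m}
  let box : (m : ℕ) → (Fin k → Fin m → Bool) → Fin k → Set E := fun m q i =>
    A i ∩ K m ∩ π m ⁻¹' {q i}
  have hbox : ∀ m q i, MeasurableSet (box m q i) := fun m q i =>
    ((hA i).inter (hK m).measurableSet).inter (hπ m (measurableSet_singleton _))
  have hG : ∀ m, G m = ⋃ q ∈ (Finset.univ.filter fun q : Fin k → Fin m → Bool => Injective q),
      univ.pi (box m q) := by
    intro m
    ext x
    simp only [G, box, mem_iUnion, Finset.mem_filter, Finset.mem_univ, true_and, mem_pi,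
      mem_univ, forall_true_left, exists_prop]
    constructor
    · rintro ⟨h1, h2⟩
      exact ⟨_, h1, fun i => ⟨h2 i, rfl⟩⟩
    · rintro ⟨q, hq, hx⟩
      have : (fun i => π m (x i)) = q := funext fun i => (hx i).2
      exact ⟨this ▸ hq, fun i => (hx i).1⟩
  have hdisj : ∀ m, (↑(Finset.univ.filter fun q : Fin k → Fin m → Bool => Injective q) :
      Set (Fin k → Fin m → Bool)).PairwiseDisjoint fun q => univ.pi (box m q) := by
    intro m q _ q' _ hne
    refine disjoint_left.2 fun x hx hx' => hne (funext fun i => ?_)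
    exact (hx i trivial).2.symm.trans (hx' i trivial).2
  have hGm : ∀ m, α (G m) = β (G m) := by
    intro m
    rw [hG, measure_biUnion_finset (hdisj m) fun q _ => MeasurableSet.univ_pi (hbox m q),
      measure_biUnion_finset (hdisj m) fun q _ => MeasurableSet.univ_pi (hbox m q)]
    refine Finset.sum_congr rfl fun q hq => h _ (hbox m q) (fun i => ?_) fun i j hij => ?_
    · exact (hK m).closure_of_subset (inter_subset_left.trans inter_subset_right)
    · refine disjoint_left.2 fun x hx hx' => hij ((Finset.mem_filter.1 hq).2 ?_)
      exact hx.2.symm.trans hx'.2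
  have hGmono : Monotone G := by
    intro m m' hmm x hx
    refine ⟨fun i j hij => hx.1 (funext fun l => ?_), fun i => ⟨(hx.2 i).1, hmono hmm (hx.2 i).2⟩⟩
    exact congrFun hij (Fin.castLE hmm l)
  have hGU : ∀ x : Fin k → E, (Injective x ∧ ∀ i, x i ∈ ⋃ n, K n) →
      (x ∈ univ.pi A ↔ x ∈ ⋃ m, G m) := by
    rintro x ⟨hx, hxK⟩
    constructor
    · intro hxA
      choose N hN using fun i => mem_iUnion.1 (hxK i)
      have hsep : ∀ i j, ∃ M : ℕ, i ≠ j → e (x i) M ≠ e (x j) M := by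
        intro i j
        by_cases hij : i = j
        · exact ⟨0, fun h => absurd hij h⟩
        · obtain ⟨M, hM⟩ := Function.ne_iff.1 fun h => hij (hx (hinj h))
          exact ⟨M, fun _ => hM⟩
      choose M hM using hsep
      let m := (Finset.univ.sup N) ⊔ (Finset.univ.sup fun z : Fin k × Fin k => M z.1 z.2 + 1)
      have hN' : ∀ i, N i ≤ m := fun i => le_sup_of_le_left (Finset.le_sup (Finset.mem_univ i))
      have hM' : ∀ i j, M i j < m := fun i j => le_sup_of_le_right
        (Finset.le_sup (f := fun z : Fin k × Fin k => M z.1 z.2 + 1) (Finset.mem_univ (i, j)))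
      refine mem_iUnion.2 ⟨m, fun i j hij => ?_, fun i => ⟨hxA i trivial, hmono (hN' i) (hN i)⟩⟩
      by_contra hne
      exact hM i j hne (congrFun hij ⟨M i j, hM' i j⟩)
    · intro hxG i _
      obtain ⟨m, hm⟩ := mem_iUnion.1 hxG
      exact (hm.2 i).1
  have hαeq : α (univ.pi A) = α (⋃ m, G m) := measure_congr <| by
    filter_upwards [hα] with x hx using propext (hGU x hx)
  have hβeq : β (univ.pi A) = β (⋃ m, G m) := measure_congr <| by
    filter_upwards [hβ] with x hx using propext (hGU x hx)
  -- Continuity from below needs no finiteness of the measures.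
  rw [hαeq, hβeq, hGmono.measure_iUnion, hGmono.measure_iUnion]
  simp_rw [hGm]

/-- Without σ-finiteness, agreement on boxes need not give equal measures, so indicators are
replaced by general functions one coordinate at a time. -/
theorem lintegral_prod_eq_of_measure_pi_eq {E : Type*} [MeasurableSpace E] {k : ℕ}
    {α β : Measure (Fin k → E)}
    (h : ∀ A : Fin k → Set E, (∀ i, MeasurableSet (A i)) → α (univ.pi A) = β (univ.pi A))
    (v : Fin k → E → ℝ≥0∞) (hv : ∀ i, Measurable (v i)) :
    ∫⁻ x, ∏ i, v i (x i) ∂α = ∫⁻ x, ∏ i, v i (x i) ∂β := by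
  classical
  suffices H : ∀ (s : Finset (Fin k)) (v : Fin k → E → ℝ≥0∞), (∀ i, Measurable (v i)) →
      (∀ i ∉ s, ∃ B, MeasurableSet B ∧ v i = B.indicator 1) →
      ∫⁻ x, ∏ i, v i (x i) ∂α = ∫⁻ x, ∏ i, v i (x i) ∂β from
    H Finset.univ v hv fun i hi => absurd (Finset.mem_univ i) hi
  intro s
  induction s using Finset.induction_on with
  | empty =>
    intro v _ hB
    choose B hB hvB using fun i => hB i (Finset.notMem_empty i)
    have key : ∀ x : Fin k → E, ∏ i, v i (x i) = (univ.pi B).indicator 1 x := by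
      intro x
      simp only [hvB, indicator_apply, mem_pi, mem_univ, forall_true_left, Pi.one_apply]
      rw [Finset.prod_ite_zero]
      simp
    simp_rw [key]
    rw [lintegral_indicator_one (MeasurableSet.univ_pi hB),
      lintegral_indicator_one (MeasurableSet.univ_pi hB), h B hB]
  | insert a s _ ih =>
    intro v hv hB
    let R : (Fin k → E) → ℝ≥0∞ := fun x => ∏ i ∈ Finset.univ.erase a, v i (x i)
    have hR : Measurable R := Finset.measurable_prod _ fun i _ =>
      (hv i).comp (measurable_pi_apply i)
    have hea : Measurable fun x : Fin k → E => x a := measurable_pi_apply a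
    have hupd : ∀ (u : E → ℝ≥0∞) (x : Fin k → E),
        ∏ i, update v a u i (x i) = R x * u (x a) := by
      intro u x
      rw [← Finset.prod_erase_mul _ _ (Finset.mem_univ a), update_self]
      congr 1
      refine Finset.prod_congr rfl fun i hi => ?_
      rw [update_of_ne (Finset.ne_of_mem_erase hi)]
    have hint : ∀ (γ : Measure (Fin k → E)) (u : E → ℝ≥0∞), Measurable u →
        ∫⁻ y, u y ∂((γ.withDensity R).map fun x => x a) =
          ∫⁻ x, ∏ i, update v a u i (x i) ∂γ := by
      intro γ u hu
      rw [lintegral_map hu hea]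
      refine (lintegral_withDensity_eq_lintegral_mul _ hR (hu.comp hea)).trans ?_
      simp_rw [hupd]
      rfl
    -- With the other factors absorbed into the density, only measures on `E` remain. The induction
    -- hypothesis, with an indicator in coordinate `a`, gives their equality on every measurable
    -- set.
    have heq : (α.withDensity R).map (fun x => x a) = (β.withDensity R).map fun x => x a := by
      ext B hBm
      have hm : Measurable (B.indicator (1 : E → ℝ≥0∞)) := measurable_one.indicator hBm
      rw [← lintegral_indicator_one hBm, ← lintegral_indicator_one hBm, hint α _ hm, hint β _ hm]
      refine ih _ (fun i => ?_) fun i hi => ?_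
      · rcases eq_or_ne i a with rfl | hia
        · rwa [update_self]
        · rw [update_of_ne hia]
          exact hv i
      · rcases eq_or_ne i a with rfl | hia
        · exact ⟨B, hBm, update_self ..⟩
        · rw [update_of_ne hia]
          exact hB i (by simp [hia, hi])
    have := congrArg (fun ν => ∫⁻ y, v a y ∂ν) heq
    simpa only [hint _ _ (hv a), update_eq_self] using this

end Boxes

/-! ### Both conditions as statements about the two families of measures. -/

section Moments

open Set Function

theorem measurePreserving_comp_perm {E : Type*} [MeasurableSpace E] (lam : Measure E)
    [SigmaFinite lam] {k : ℕ} (σ : Equiv.Perm (Fin k)) :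
    MeasurePreserving (fun x : Fin k → E => x ∘ σ) (Measure.pi fun _ => lam)
      (Measure.pi fun _ => lam) := by
  convert measurePreserving_piCongrLeft (fun _ : Fin k => lam) σ.symm using 1
  funext x i
  obtain ⟨j, rfl⟩ := σ.symm.surjective i
  rw [MeasurableEquiv.coe_piCongrLeft, Equiv.piCongrLeft_apply_apply]
  simp

/-- The measure on `E^k` with density `ρ_k` with respect to the product measure. -/
noncomputable def densityMeasure {E : Type*} [MeasurableSpace E] (lam : Measure E)
    (ρ : (k : ℕ) → (Fin k → E) → ℝ≥0) (k : ℕ) : Measure (Fin k → E) :=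
  (Measure.pi fun _ => lam).withDensity fun x => (ρ k x : ℝ≥0∞)

theorem densityMeasure_map_perm {E : Type*} [MeasurableSpace E] (lam : Measure E)
    [SigmaFinite lam] {ρ : (k : ℕ) → (Fin k → E) → ℝ≥0} (hmeas : ∀ k, Measurable (ρ k))
    (hsymm : ∀ (k : ℕ) (σ : Equiv.Perm (Fin k)) (x : Fin k → E), ρ k (x ∘ σ) = ρ k x)
    (k : ℕ) (σ : Equiv.Perm (Fin k)) :
    (densityMeasure lam ρ k).map (fun x => x ∘ σ) = densityMeasure lam ρ k := by
  have hσ := measurePreserving_comp_perm lam σ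
  ext B hB
  have hm : Measurable (B.indicator fun x => (ρ k x : ℝ≥0∞)) :=
    (hmeas k).coe_nnreal_ennreal.indicator hB
  rw [Measure.map_apply hσ.measurable hB, densityMeasure,
    withDensity_apply _ (hσ.measurable hB), withDensity_apply _ hB,
    ← lintegral_indicator (hσ.measurable hB), ← lintegral_indicator hB,
    ← hσ.lintegral_comp hm]
  refine lintegral_congr fun x => ?_
  simp only [indicator, hsymm]
  rfl

theorem densityMeasure_ae {E : Type*} [MeasurableSpace E] {lam : Measure E} [SigmaFinite lam]
    {ρ : (k : ℕ) → (Fin k → E) → ℝ≥0} (hmeas : ∀ k, Measurable (ρ k))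
    (hdiag : ∀ k, ∀ᵐ x ∂(Measure.pi fun _ : Fin k => lam), ¬ Injective x → ρ k x = 0)
    {S : Set E} (h : ∀ᵐ x ∂lam, x ∈ S) (k : ℕ) :
    ∀ᵐ x ∂densityMeasure lam ρ k, Injective x ∧ ∀ i, x i ∈ S := by
  rw [densityMeasure, ae_withDensity_iff (hmeas k).coe_nnreal_ennreal]
  have hS : ∀ᵐ x ∂(Measure.pi fun _ : Fin k => lam), ∀ i, x i ∈ S :=
    ae_all_iff.2 fun i => Measure.tendsto_eval_ae_ae.eventually h
  filter_upwards [hdiag k, hS] with x hx hxS hne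
  refine ⟨?_, hxS⟩
  by_contra hinj
  exact hne (by rw [hx hinj, ENNReal.coe_zero])

/-- A block with two indices puts one point in two disjoint sets and contributes zero. Only the
discrete partition remains; its blocks are numbered arbitrarily, hence the permutation invariance.
-/
theorem sum_lintegral_indicator_eq {E : Type*} [MeasurableSpace E]
    {γ : (k : ℕ) → Measure (Fin k → E)}
    (hγ : ∀ (k : ℕ) (σ : Equiv.Perm (Fin k)), (γ k).map (fun x => x ∘ σ) = γ k)
    {n : ℕ} {A : Fin n → Set E} (hA : ∀ i, MeasurableSet (A i))
    (hdisj : Pairwise fun i j => Disjoint (A i) (A j)) :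
    ∑ P : Finpartition (Finset.univ : Finset (Fin n)), ∫⁻ x,
        ((∏ l, ∏ i ∈ (P.parts.equivFin.symm l).1, (A i).indicator 1 (x l) : ℝ≥0) : ℝ≥0∞)
          ∂(γ P.parts.card) = γ n (univ.pi A) := by
  classical
  have hbot : Injective (⊥ : Finpartition (Finset.univ : Finset (Fin n))).blockIndex := by
    intro i j hij
    rw [Finpartition.blockIndex_eq_blockIndex_iff] at hij
    obtain ⟨a, -, ha⟩ := Finpartition.mem_bot_iff.1
      ((⊥ : Finpartition (Finset.univ : Finset (Fin n))).part_mem.2 (Finset.mem_univ j))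
    have hj := (⊥ : Finpartition (Finset.univ : Finset (Fin n))).mem_part_self.2
      (Finset.mem_univ j)
    rw [← ha, Finset.mem_singleton] at hij hj
    rw [hij, hj]
  -- The number of blocks equals `n` only propositionally, so it is generalized to `m` before being
  -- identified with `n`.
  have hreindex : ∀ (m : ℕ) (e : Fin n → Fin m), Bijective e →
      ∫⁻ x, ((∏ i, (A i).indicator 1 (x (e i)) : ℝ≥0) : ℝ≥0∞) ∂(γ m) = γ n (univ.pi A) := by
    intro m e he
    obtain rfl : n = m := by simpa using Fintype.card_of_bijective he
    have hB := MeasurableSet.univ_pi hA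
    have hσ : Measurable fun x : Fin n → E => x ∘ Equiv.ofBijective e he :=
      measurable_pi_lambda _ fun i => measurable_pi_apply _
    rw [← hγ n (Equiv.ofBijective e he), Measure.map_apply hσ hB,
      ← lintegral_indicator_one (hσ hB)]
    rw [hγ]
    refine lintegral_congr fun x => ?_
    simp only [indicator_apply, Pi.one_apply, mem_preimage, mem_pi, mem_univ, forall_true_left,
      comp_apply, Equiv.ofBijective_apply]
    rw [Finset.prod_ite_zero]
    by_cases h : ∀ i, x (e i) ∈ A i <;> simp [h]
  rw [Finset.sum_eq_single ⊥]
  · simp_rw [Finpartition.prod_parts_eq ⊥ fun i l => (A i).indicator (1 : E → ℝ≥0) _]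
    exact hreindex _ _ ⟨hbot, Finpartition.blockIndex_surjective _⟩
  · intro P _ hP
    have hni : ¬ Injective P.blockIndex := fun hinj => hP <|
      Finpartition.eq_of_mem_part_iff fun i j => by
        rw [← Finpartition.blockIndex_eq_blockIndex_iff,
          ← Finpartition.blockIndex_eq_blockIndex_iff, hinj.eq_iff, hbot.eq_iff]
    obtain ⟨i, j, hij, hne⟩ : ∃ i j, P.blockIndex i = P.blockIndex j ∧ i ≠ j := by
      simpa [Injective] using hni
    rw [lintegral_congr (g := 0) fun x => ?_, Pi.zero_def, lintegral_zero]
    rw [Finpartition.prod_parts_eq P fun i l => (A i).indicator (1 : E → ℝ≥0) (x l)]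
    have hzero : ∃ a, (A a).indicator (1 : E → ℝ≥0) (x (P.blockIndex a)) = 0 := by
      by_cases hx : x (P.blockIndex i) ∈ A i
      · refine ⟨j, indicator_of_notMem (fun hx' => ?_) _⟩
        exact disjoint_left.1 (hdisj hne) hx (hij ▸ hx')
      · exact ⟨i, indicator_of_notMem hx _⟩
    obtain ⟨a, ha⟩ := hzero
    rw [Finset.prod_eq_zero (Finset.mem_univ a) ha]
    rfl
  · simp

theorem Configuration.integral_indicator_one {E : Type*} [TopologicalSpace E]
    (ξ : Configuration E) (A : Set E) :
    ξ.integral (A.indicator 1) = ξ.count A := by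
  have h : ∀ x : E, ((A.indicator (1 : E → ℝ≥0) x : ℝ≥0) : ℝ≥0∞) = A.indicator 1 x := fun x => by
    by_cases hx : x ∈ A <;> simp [hx]
  simp only [integral, count, h]
  rw [tsum_subtype ξ.carrier (A.indicator (1 : E → ℝ≥0∞)), indicator_indicator,
    ← tsum_subtype, ← ENNReal.tsum_set_one]
  rfl

variable {E : Type*} [TopologicalSpace E] [MeasurableSpace E] [PolishSpace E] [BorelSpace E]

theorem factorialMoment_map_perm (μ : Measure (Configuration E)) (k : ℕ)
    (σ : Equiv.Perm (Fin k)) :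
    (factorialMoment μ k).map (fun x => x ∘ σ) = factorialMoment μ k := by
  have hσ : Measurable fun x : Fin k → E => x ∘ σ :=
    measurable_pi_lambda _ fun i => measurable_pi_apply _
  ext B hB
  have hm : Measurable (B.indicator (1 : (Fin k → E) → ℝ≥0∞)) := measurable_one.indicator hB
  rw [← lintegral_indicator_one hB, ← lintegral_indicator_one hB, lintegral_map hm hσ,
    lintegral_factorialMoment μ (g := fun x => B.indicator 1 (x ∘ σ)) (hm.comp hσ),
    lintegral_factorialMoment μ hm]
  refine lintegral_congr fun ξ => ?_
  have hbij : BijOn (fun x : Fin k → E => x ∘ σ) (ξ.tuples k) (ξ.tuples k) := by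
    refine ⟨fun x hx => ⟨hx.1.comp σ.injective, fun i => hx.2 _⟩,
      σ.surjective.injective_comp_right.injOn, fun x hx => ?_⟩
    exact ⟨x ∘ σ.symm, ⟨hx.1.comp σ.symm.injective, fun i => hx.2 _⟩, by ext; simp⟩
  exact (hbij.equiv _).tsum_eq fun x : ξ.tuples k => B.indicator (1 : (Fin k → E) → ℝ≥0∞) x.1

theorem factorialMoment_ae {μ : Measure (Configuration E)} {S : Set E} (hS : MeasurableSet S)
    (h : ∀ᵐ ξ ∂μ, ξ.carrier ⊆ S) (k : ℕ) :
    ∀ᵐ x ∂factorialMoment μ k, Injective x ∧ ∀ i, x i ∈ S := by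
  have hm : MeasurableSet {x : Fin k → E | Injective x ∧ ∀ i, x i ∈ S} := by
    have h1 : {x : Fin k → E | Injective x ∧ ∀ i, x i ∈ S} =
        (⋂ i, ⋂ j, {x : Fin k → E | x i = x j → i = j}) ∩ ⋂ i, (fun x => x i) ⁻¹' S := by
      ext x
      simp [Injective]
    rw [h1]
    refine (MeasurableSet.iInter fun i => MeasurableSet.iInter fun j => ?_).inter
      (MeasurableSet.iInter fun i => measurable_pi_apply i hS)
    exact (measurableSet_eq_fun (measurable_pi_apply i) (measurable_pi_apply j)).imp
      (MeasurableSet.const _)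
  rw [ae_iff]
  change factorialMoment μ k {x : Fin k → E | Injective x ∧ ∀ i, x i ∈ S}ᶜ = 0
  rw [← lintegral_indicator_one hm.compl,
    lintegral_factorialMoment μ (measurable_one.indicator hm.compl),
    lintegral_congr_ae (g := 0) ?_, Pi.zero_def, lintegral_zero]
  filter_upwards [h] with ξ hξ
  refine ENNReal.tsum_eq_zero.2 fun x => indicator_of_notMem ?_ _
  exact fun hx => hx ⟨x.2.1, fun i => hξ (x.2.2 i)⟩

theorem hasCorrelationFunctions_iff (μ : Measure (Configuration E)) (lam : Measure E)
    [SigmaFinite lam] (ρ : (k : ℕ) → (Fin k → E) → ℝ≥0) :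
    HasCorrelationFunctions μ lam ρ ↔ ∀ (n : ℕ) (A : Fin n → Set E), (∀ i, MeasurableSet (A i)) →
      (∀ i, IsCompact (closure (A i))) → Pairwise (fun i j => Disjoint (A i) (A j)) →
      factorialMoment μ n (univ.pi A) = densityMeasure lam ρ n (univ.pi A) := by
  refine forall_congr' fun n => forall_congr' fun A => forall_congr' fun hA =>
    forall_congr' fun _ => forall_congr' fun hdisj => ?_
  rw [densityMeasure, withDensity_apply _ (MeasurableSet.univ_pi hA)]
  simp_rw [← Configuration.integral_indicator_one]
  rw [lintegral_prod_integral μ _ fun i => measurable_one.indicator (hA i),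
    sum_lintegral_indicator_eq (factorialMoment_map_perm μ) hA hdisj]

theorem momentFormula_iff (μ : Measure (Configuration E)) (lam : Measure E)
    [SigmaFinite lam] {ρ : (k : ℕ) → (Fin k → E) → ℝ≥0} (hmeas : ∀ k, Measurable (ρ k)) :
    MomentFormula μ lam ρ ↔ ∀ (n : ℕ) (v : Fin n → E → ℝ≥0), (∀ i, Measurable (v i)) →
      ∑ P : Finpartition (Finset.univ : Finset (Fin n)), ∫⁻ x,
        ((∏ l, ∏ i ∈ (P.parts.equivFin.symm l).1, v i (x l) : ℝ≥0) : ℝ≥0∞)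
          ∂(factorialMoment μ P.parts.card) =
      ∑ P : Finpartition (Finset.univ : Finset (Fin n)), ∫⁻ x,
        ((∏ l, ∏ i ∈ (P.parts.equivFin.symm l).1, v i (x l) : ℝ≥0) : ℝ≥0∞)
          ∂(densityMeasure lam ρ P.parts.card) := by
  refine forall_congr' fun n => forall_congr' fun v => forall_congr' fun hv => ?_
  rw [lintegral_prod_integral μ v hv]
  refine Eq.congr rfl (Finset.sum_congr rfl fun P _ => ?_)
  have hm : Measurable fun x : Fin P.parts.card → E =>
      ((∏ l, ∏ i ∈ (P.parts.equivFin.symm l).1, v i (x l) : ℝ≥0) : ℝ≥0∞) :=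
    (Finset.measurable_prod _ fun l _ => Finset.measurable_prod _ fun i _ =>
      (hv i).comp (measurable_pi_apply l)).coe_nnreal_ennreal
  rw [densityMeasure,
    lintegral_withDensity_eq_lintegral_mul _ (hmeas _).coe_nnreal_ennreal hm]
  refine lintegral_congr fun x => ?_
  rw [Pi.mul_apply, mul_comm, ENNReal.coe_mul]

/-- For each partition the integrand is a product of functions of one coordinate each, so the sums
agree term by term. -/
theorem momentFormula_of_measure_pi_eq {μ : Measure (Configuration E)} {lam : Measure E}
    [SigmaFinite lam] {ρ : (k : ℕ) → (Fin k → E) → ℝ≥0} (hmeas : ∀ k, Measurable (ρ k))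
    (h : ∀ (n : ℕ) (A : Fin n → Set E), (∀ i, MeasurableSet (A i)) →
      factorialMoment μ n (univ.pi A) = densityMeasure lam ρ n (univ.pi A)) :
    MomentFormula μ lam ρ := by
  rw [momentFormula_iff μ lam hmeas]
  intro n v hv
  refine Finset.sum_congr rfl fun P _ => ?_
  simp_rw [ENNReal.ofNNReal_finsetProd (Finset.univ)]
  exact lintegral_prod_eq_of_measure_pi_eq (h _)
    (fun l y => ((∏ i ∈ (P.parts.equivFin.symm l).1, v i y : ℝ≥0) : ℝ≥0∞))
    fun l => (Finset.measurable_prod _ fun i _ => hv i).coe_nnreal_ennreal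

theorem HasCorrelationFunctions.measure_pi_eq {μ : Measure (Configuration E)} [IsFiniteMeasure μ]
    {lam : Measure E} [SigmaFinite lam] {ρ : (k : ℕ) → (Fin k → E) → ℝ≥0}
    (h : HasCorrelationFunctions μ lam ρ) (hmeas : ∀ k, Measurable (ρ k))
    (hdiag : ∀ k, ∀ᵐ x ∂(Measure.pi fun _ : Fin k => lam), ¬ Injective x → ρ k x = 0)
    (n : ℕ) (A : Fin n → Set E) (hA : ∀ i, MeasurableSet (A i)) :
    factorialMoment μ n (univ.pi A) = densityMeasure lam ρ n (univ.pi A) := by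
  obtain ⟨K, hK, hmono, hlam, hμ⟩ := exists_compact_exhaustion lam μ
  have hS : MeasurableSet (⋃ n, K n) := MeasurableSet.iUnion fun n => (hK n).measurableSet
  exact measure_pi_eq_of_disjoint hK hmono (factorialMoment_ae hS hμ n)
    (densityMeasure_ae hmeas hdiag hlam n) ((hasCorrelationFunctions_iff μ lam ρ).1 h n) A hA

theorem MomentFormula.hasCorrelationFunctions {μ : Measure (Configuration E)}
    {lam : Measure E} [SigmaFinite lam] {ρ : (k : ℕ) → (Fin k → E) → ℝ≥0}
    (h : MomentFormula μ lam ρ) (hmeas : ∀ k, Measurable (ρ k))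
    (hsymm : ∀ (k : ℕ) (σ : Equiv.Perm (Fin k)) (x : Fin k → E), ρ k (x ∘ σ) = ρ k x) :
    HasCorrelationFunctions μ lam ρ := by
  rw [hasCorrelationFunctions_iff]
  intro n A hA _ hdisj
  rw [← sum_lintegral_indicator_eq (factorialMoment_map_perm μ) hA hdisj,
    ← sum_lintegral_indicator_eq (densityMeasure_map_perm lam hmeas hsymm) hA hdisj]
  exact (momentFormula_iff μ lam hmeas).1 h n _ fun i => measurable_one.indicator (hA i)

end Moments

/-! ### Sums over finite subconfigurations and the sample-measure definition. -/

section Sample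

open Set Function

theorem ae_injective_pi {E : Type*} [MeasurableSpace E] [MeasurableEq E] (lam : Measure E)
    [SigmaFinite lam] (h0 : ∀ x, lam {x} = 0) (k : ℕ) :
    ∀ᵐ x ∂(Measure.pi fun _ : Fin k => lam), Injective x := by
  have : ∀ i j, ∀ᵐ x ∂(Measure.pi fun _ : Fin k => lam), x i = x j → i = j := by
    intro i j
    rcases eq_or_ne i j with rfl | hij
    · simp
    obtain ⟨k, rfl⟩ : ∃ m, k = m + 1 := ⟨k - 1, by have := i.pos; omega⟩
    obtain ⟨l, rfl⟩ := Fin.exists_succAbove_eq hij.symm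
    have hms : MeasurableSet {z : E × (Fin k → E) | z.1 = z.2 l} :=
      measurableSet_eq_fun measurable_fst ((measurable_pi_apply l).comp measurable_snd)
    -- Fubini: once `x i` is fixed, the other coordinate must hit a single point, which is not an
    -- atom.
    have hpre : (Measure.pi fun _ : Fin (k + 1) => lam) {x | x i = x (i.succAbove l)} = 0 := by
      have hmp := measurePreserving_piFinSuccAbove (fun _ : Fin (k + 1) => lam) i
      change (Measure.pi fun _ : Fin (k + 1) => lam)
        ((MeasurableEquiv.piFinSuccAbove (fun _ => E) i) ⁻¹' {z | z.1 = z.2 l}) = 0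
      rw [hmp.measure_preimage hms.nullMeasurableSet, Measure.measure_prod_null hms]
      refine Filter.Eventually.of_forall fun a => ?_
      have hev : ∀ᵐ b ∂lam, b ≠ a := by
        rw [ae_iff]
        simpa using h0 a
      have hev' : ∀ᵐ y ∂(Measure.pi fun _ : Fin k => lam), y l ≠ a :=
        (Measure.tendsto_eval_ae_ae (μ := fun _ : Fin k => lam) (i := l)).eventually hev
      have : ∀ᵐ y ∂(Measure.pi fun _ : Fin k => lam), ¬ a = y l := by
        filter_upwards [hev'] with y hy h using hy h.symm
      rw [ae_iff] at this
      simpa using this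
    have : ∀ᵐ x ∂(Measure.pi fun _ : Fin (k + 1) => lam), ¬ x i = x (i.succAbove l) := by
      rw [ae_iff]
      simpa using hpre
    filter_upwards [this] with x hx h using absurd h hx
  filter_upwards [ae_all_iff.2 fun i => ae_all_iff.2 (this i)] with x hx i j h using hx i j h

theorem Function.Injective.encard_range_fin {E : Type*} {n : ℕ} {x : Fin n → E} (hx : Injective x) :
    (range x).encard = n := by
  rw [← image_univ, hx.encard_image, encard_univ]
  simp

namespace FiniteConfiguration

variable {E : Type*} [TopologicalSpace E]

/-- The tuples that enumerate a finite configuration without repetition. -/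
def enumerations (α : FiniteConfiguration E) (n : ℕ) : Set (Fin n → E) :=
  {x | Injective x ∧ range x = α.1.carrier}

theorem ofTuple_eq_iff {α : FiniteConfiguration E} {n : ℕ} {x : Fin n → E} :
    ofTuple x = α ↔ range x = α.1.carrier := by
  constructor
  · rintro rfl
    rfl
  · rcases α with ⟨⟨s, hs⟩, hs'⟩
    intro h
    simp only at h
    subst h
    rfl

theorem exists_eq_ofTuple (α : FiniteConfiguration E) :
    ∃ (n : ℕ) (x : Fin n → E), Injective x ∧ ofTuple x = α := by
  have := α.2.to_subtype
  obtain ⟨n, ⟨e⟩⟩ := Finite.exists_equiv_fin α.1.carrier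
  refine ⟨n, fun i => e.symm i, Subtype.val_injective.comp e.symm.injective,
    ofTuple_eq_iff.2 ?_⟩
  change range (Subtype.val ∘ e.symm) = _
  rw [e.symm.surjective.range_comp, Subtype.range_coe]

theorem enumerations_ofTuple_of_ne {m n : ℕ} (h : n ≠ m) {x : Fin m → E} (hx : Injective x) :
    (ofTuple x).enumerations n = ∅ := by
  refine eq_empty_of_forall_notMem fun y hy => h ?_
  have h1 := hy.1.encard_range_fin
  have h2 := hx.encard_range_fin
  have h3 : range y = range x := hy.2
  rw [h3, h2] at h1
  exact_mod_cast h1.symm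

theorem tsum_enumerations_ofTuple {n : ℕ} {x : Fin n → E} (hx : Injective x)
    (g : (Fin n → E) → ℝ≥0∞) :
    ∑' y : (ofTuple x).enumerations n, g y = ∑ σ : Equiv.Perm (Fin n), g (x ∘ σ) := by
  have hbij : Bijective fun σ : Equiv.Perm (Fin n) =>
      (⟨x ∘ σ, hx.comp σ.injective, σ.surjective.range_comp x⟩ :
        (ofTuple x).enumerations n) := by
    constructor
    · intro σ τ h
      ext i
      rw [hx (congrFun (congrArg Subtype.val h) i)]
    · rintro ⟨y, hy, hyx⟩
      have hyx : range y = range x := hyx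
      have hmem : ∀ i, ∃ j, x j = y i := fun i => by
        have := mem_range_self (f := y) i
        rwa [hyx] at this
      choose s hs using hmem
      have hsinj : Injective s := fun i j hij => hy (by rw [← hs i, ← hs j, hij])
      exact ⟨Equiv.ofBijective s (Finite.injective_iff_bijective.1 hsinj),
        Subtype.ext (funext hs)⟩
  rw [← (Equiv.ofBijective _ hbij).tsum_eq, tsum_fintype]
  rfl

/-- Needed because test functions take values in `ℝ≥0`; a finite configuration has only finitely
many enumerations. -/
theorem tsum_enumerations_ne_top (α : FiniteConfiguration E) {n : ℕ}
    {g : (Fin n → E) → ℝ≥0∞} (hg : ∀ x, g x ≠ ∞) : ∑' x : α.enumerations n, g x ≠ ∞ := by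
  obtain ⟨m, x, hx, rfl⟩ := α.exists_eq_ofTuple
  rcases eq_or_ne n m with rfl | h
  · rw [tsum_enumerations_ofTuple hx]
    exact ENNReal.sum_ne_top.2 fun σ _ => hg _
  · have := isEmpty_coe_sort.2 (enumerations_ofTuple_of_ne h hx)
    simp

/-- Symmetrization: a symmetric function of tuples is recovered by averaging over enumerations. -/
theorem tsum_tsum_enumerations {m : ℕ} {x : Fin m → E} (hx : Injective x)
    (g : (n : ℕ) → (Fin n → E) → ℝ≥0∞)
    (hg : ∀ σ : Equiv.Perm (Fin m), g m (x ∘ σ) = g m x) :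
    ∑' n : ℕ, ((n.factorial : ℝ≥0∞))⁻¹ * ∑' y : (ofTuple x).enumerations n, g n y = g m x := by
  rw [tsum_eq_single m]
  · rw [tsum_enumerations_ofTuple hx]
    simp only [hg, Finset.sum_const, Finset.card_univ, Fintype.card_perm, Fintype.card_fin,
      nsmul_eq_mul]
    rw [← mul_assoc, ENNReal.inv_mul_cancel (by exact_mod_cast m.factorial_ne_zero) (by simp),
      one_mul]
  · intro n h
    have := isEmpty_coe_sort.2 (enumerations_ofTuple_of_ne h hx)
    simp

theorem ofTuple_comp_perm {n : ℕ} (x : Fin n → E) (σ : Equiv.Perm (Fin n)) :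
    ofTuple (x ∘ σ) = ofTuple x :=
  ofTuple_eq_iff.2 (σ.surjective.range_comp x)

/-- Each injective tuple of points of `ξ` enumerates exactly one finite subset of `ξ`. -/
theorem tsum_subset_tsum_enumerations (ξ : Configuration E) {n : ℕ} (g : (Fin n → E) → ℝ≥0∞) :
    ∑' α : {α : FiniteConfiguration E // α.1.carrier ⊆ ξ.carrier},
      ∑' x : α.1.enumerations n, g x = ∑' x : ξ.tuples n, g x := by
  have hbij : Bijective fun z : Σ α : {α : FiniteConfiguration E // α.1.carrier ⊆ ξ.carrier},
      α.1.enumerations n => (⟨z.2.1, z.2.2.1, fun i => z.1.2 (by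
        rw [← z.2.2.2]; exact mem_range_self i)⟩ : ξ.tuples n) := by
    constructor
    · rintro ⟨⟨α, hα⟩, y, hy⟩ ⟨⟨β, hβ⟩, z, hz⟩ h
      obtain rfl : y = z := congrArg Subtype.val h
      obtain rfl : α = β := (ofTuple_eq_iff.2 hy.2).symm.trans (ofTuple_eq_iff.2 hz.2)
      rfl
    · rintro ⟨x, hx, hxξ⟩
      exact ⟨⟨⟨ofTuple x, range_subset_iff.2 hxξ⟩, x, hx, rfl⟩, rfl⟩
  rw [← (Equiv.ofBijective _ hbij).tsum_eq, ENNReal.tsum_sigma']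
  rfl

theorem tsum_subset_eq (ξ : Configuration E) (f : FiniteConfiguration E → ℝ≥0) :
    ∑' α : {α : FiniteConfiguration E // α.1.carrier ⊆ ξ.carrier}, (f α.1 : ℝ≥0∞) =
      ∑' n : ℕ, ((n.factorial : ℝ≥0∞))⁻¹ * ∑' x : ξ.tuples n, (f (ofTuple x.1) : ℝ≥0∞) := by
  have h : ∀ α : FiniteConfiguration E, (f α : ℝ≥0∞) = ∑' n : ℕ, ((n.factorial : ℝ≥0∞))⁻¹ *
      ∑' x : α.enumerations n, (f (ofTuple x.1) : ℝ≥0∞) := by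
    intro α
    obtain ⟨m, x, hx, rfl⟩ := α.exists_eq_ofTuple
    exact (tsum_tsum_enumerations hx (fun n y => (f (ofTuple y) : ℝ≥0∞)) fun σ => by
      rw [ofTuple_comp_perm]).symm
  calc _ = ∑' α : {α : FiniteConfiguration E // α.1.carrier ⊆ ξ.carrier}, ∑' n : ℕ,
        ((n.factorial : ℝ≥0∞))⁻¹ * ∑' x : α.1.enumerations n, (f (ofTuple x.1) : ℝ≥0∞) :=
        tsum_congr fun α => h α.1
    _ = _ := by
        rw [ENNReal.tsum_comm]
        refine tsum_congr fun n => ?_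
        rw [ENNReal.tsum_mul_left,
          tsum_subset_tsum_enumerations ξ fun x => (f (ofTuple x) : ℝ≥0∞)]

variable [MeasurableSpace E]

theorem measurable_ofTuple [PolishSpace E] [BorelSpace E] (n : ℕ) :
    Measurable (ofTuple : (Fin n → E) → FiniteConfiguration E) := by
  refine Measurable.subtype_mk ?_
  rw [measurable_iff_comap_le]
  simp only [Configuration.instMeasurableSpace, MeasurableSpace.comap_iSup, MeasurableSpace.comap_comp]
  refine iSup₂_le fun B hB => ?_
  rw [← measurable_iff_comap_le]
  -- Indices of first occurrences of points in `B`: they count the points without repetition, and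
  -- `J` has finitely many values.
  let J : (Fin n → E) → Set (Fin n) := fun x => {i | x i ∈ B ∧ ∀ j, j < i → x j ≠ x i}
  have hJ : Measurable J := by
    refine measurable_set_iff.2 fun i => measurable_to_prop ?_
    have : (fun x : Fin n → E => i ∈ J x) ⁻¹' {True} =
        (fun x => x i) ⁻¹' B ∩ ⋂ j, {x | j < i → x j ≠ x i} := by
      ext x
      simp [J]
    rw [this]
    refine (measurable_pi_apply i hB).inter (MeasurableSet.iInter fun j => ?_)
    exact (MeasurableSet.const _).imp
      (measurableSet_eq_fun (measurable_pi_apply j) (measurable_pi_apply i)).compl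
  have heq : ∀ x : Fin n → E, (range x ∩ B).encard = (J x).encard := by
    intro x
    have himg : range x ∩ B = x '' J x := by
      ext y
      constructor
      · rintro ⟨⟨i, rfl⟩, hi⟩
        have hex : ∃ j, x j = x i := ⟨i, rfl⟩
        obtain ⟨j, hj, hmin⟩ := WellFounded.has_min (wellFounded_lt (α := Fin n))
          {j | x j = x i} hex
        have hj : x j = x i := hj
        refine ⟨j, ⟨hj ▸ hi, fun l hl h => hmin l (h.trans hj) hl⟩, hj⟩
      · rintro ⟨i, hi, rfl⟩
        exact ⟨mem_range_self i, hi.1⟩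
    rw [himg, InjOn.encard_image]
    intro i hi j hj hij
    rcases lt_trichotomy i j with h | h | h
    · exact absurd hij (hj.2 i h)
    · exact h
    · exact absurd hij.symm (hi.2 j h)
  have : ((fun ξ : Configuration E => ξ.count B) ∘
      fun x : Fin n → E => (⟨range x, fun _ _ => (finite_range x).inter_of_left _⟩ :
        Configuration E)) = Set.encard ∘ J := funext heq
  rw [this]
  exact (@Measurable.of_discrete _ _ _ ⊤ _ _).comp hJ

/-- If `α` has `n` points, its enumerations are its injective `n`-tuples; otherwise there are none.
-/
theorem measurable_tsum_enumerations [PolishSpace E] [BorelSpace E] {n : ℕ}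
    {g : (Fin n → E) → ℝ≥0∞} (hg : Measurable g) :
    Measurable fun α : FiniteConfiguration E => ∑' x : α.enumerations n, g x := by
  have hc : MeasurableSet {α : FiniteConfiguration E | α.1.count univ ∈ ({(n : ℕ∞)} : Set ℕ∞)} :=
    measurable_subtype_coe (Configuration.measurableSet_count MeasurableSet.univ _)
  have heq : (fun α : FiniteConfiguration E => ∑' x : α.enumerations n, g x) =
      {α : FiniteConfiguration E | α.1.count univ ∈ ({(n : ℕ∞)} : Set ℕ∞)}.indicator
        fun α => ∑' x : α.1.tuples n, g x := by
    funext α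
    by_cases h : α.1.count univ = n
    · rw [indicator_of_mem (show α ∈ {α : FiniteConfiguration E | α.1.count univ ∈ ({(n : ℕ∞)} : Set ℕ∞)} from h)]
      have : α.enumerations n = α.1.tuples n := by
        ext x
        refine and_congr_right fun hx => ⟨fun hr i => hr ▸ mem_range_self i, fun hi => ?_⟩
        refine (finite_range x).eq_of_subset_of_encard_le (range_subset_iff.2 hi) ?_
        rw [hx.encard_range_fin]
        simpa [Configuration.count] using h.le
      rw [this]
    · rw [indicator_of_notMem (show α ∉ {α : FiniteConfiguration E | α.1.count univ ∈ ({(n : ℕ∞)} : Set ℕ∞)} from h)]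
      have : IsEmpty (α.enumerations n) := by
        refine isEmpty_coe_sort.2 (eq_empty_of_forall_notMem fun x hx => h ?_)
        rw [Configuration.count, inter_univ, ← hx.2, hx.1.encard_range_fin]
      simp
  rw [heq]
  exact ((Configuration.measurable_tsum_tuples hg).comp measurable_subtype_coe).indicator hc

end FiniteConfiguration

open FiniteConfiguration

variable {E : Type*} [TopologicalSpace E] [MeasurableSpace E] [PolishSpace E] [BorelSpace E]

theorem lintegral_tsum_subset (μ : Measure (Configuration E)) {f : FiniteConfiguration E → ℝ≥0}
    (hf : Measurable f) :
    ∫⁻ ξ, ∑' α : {α : FiniteConfiguration E // α.1.carrier ⊆ ξ.carrier}, (f α.1 : ℝ≥0∞) ∂μ =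
      ∑' n : ℕ, ((n.factorial : ℝ≥0∞))⁻¹ *
        ∫⁻ x, (f (ofTuple x) : ℝ≥0∞) ∂factorialMoment μ n := by
  have hm : ∀ n, Measurable fun x : Fin n → E => (f (ofTuple x) : ℝ≥0∞) := fun n =>
    (hf.comp (measurable_ofTuple n)).coe_nnreal_ennreal
  simp_rw [tsum_subset_eq]
  rw [lintegral_tsum fun n => ((Configuration.measurable_tsum_tuples (hm n)).const_mul
    _).aemeasurable]
  refine tsum_congr fun n => ?_
  rw [lintegral_const_mul _ (Configuration.measurable_tsum_tuples (hm n)),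
    lintegral_factorialMoment μ (hm n)]

theorem lintegral_ofTuple_mul {lam : Measure E} [SigmaFinite lam] (h0 : ∀ x, lam {x} = 0)
    {ρ : (n : ℕ) → (Fin n → E) → ℝ≥0} (hmeas : ∀ k, Measurable (ρ k))
    {r : FiniteConfiguration E → ℝ≥0}
    (hr : ∀ (n : ℕ) (x : Fin n → E), Injective x → r (ofTuple x) = ρ n x)
    {f : FiniteConfiguration E → ℝ≥0} (hf : Measurable f) (n : ℕ) :
    ∫⁻ x : Fin n → E, ((f (ofTuple x) * r (ofTuple x) : ℝ≥0) : ℝ≥0∞) ∂(Measure.pi fun _ => lam) =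
      ∫⁻ x, (f (ofTuple x) : ℝ≥0∞) ∂densityMeasure lam ρ n := by
  have hm : Measurable fun x : Fin n → E => (f (ofTuple x) : ℝ≥0∞) :=
    (hf.comp (measurable_ofTuple n)).coe_nnreal_ennreal
  rw [densityMeasure, lintegral_withDensity_eq_lintegral_mul _ (hmeas n).coe_nnreal_ennreal hm]
  refine lintegral_congr_ae ?_
  filter_upwards [ae_injective_pi lam h0 n] with x hx
  rw [hr n x hx, Pi.mul_apply, mul_comm, ENNReal.coe_mul]

/-- Test (**) with the number of enumerations of `α` lying in `B`. The left side counts injective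
tuples of `ξ` in `B`. On the right only level `n` survives, where the `n!` permutations cancel the
factor `1/n!`. -/
theorem HasSampleCorrelationFunctions.factorialMoment_eq {μ : Measure (Configuration E)}
    {lam : Measure E} [SigmaFinite lam] {ρ : (n : ℕ) → (Fin n → E) → ℝ≥0}
    (h : HasSampleCorrelationFunctions μ lam ρ) (h0 : ∀ x, lam {x} = 0)
    (hmeas : ∀ k, Measurable (ρ k))
    (hsymm : ∀ (k : ℕ) (σ : Equiv.Perm (Fin k)) (x : Fin k → E), ρ k (x ∘ σ) = ρ k x) (n : ℕ) :
    factorialMoment μ n = densityMeasure lam ρ n := by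
  obtain ⟨r, ⟨-, hr⟩, hrρ⟩ := h
  ext B hB
  have hg : Measurable (B.indicator (1 : (Fin n → E) → ℝ≥0∞)) := measurable_one.indicator hB
  have hgtop : ∀ x, B.indicator (1 : (Fin n → E) → ℝ≥0∞) x ≠ ∞ := fun x => by
    by_cases hx : x ∈ B <;> simp [hx]
  let f : FiniteConfiguration E → ℝ≥0 := fun α =>
    (∑' x : α.enumerations n, B.indicator (1 : (Fin n → E) → ℝ≥0∞) x).toNNReal
  have hf : Measurable f := (measurable_tsum_enumerations hg).ennreal_toNNReal
  have hfcoe : ∀ α, (f α : ℝ≥0∞) =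
      ∑' x : α.enumerations n, B.indicator (1 : (Fin n → E) → ℝ≥0∞) x := fun α =>
    ENNReal.coe_toNNReal (tsum_enumerations_ne_top α hgtop)
  have hae : ∀ m, ∀ᵐ x ∂densityMeasure lam ρ m, Injective x := fun m =>
    (withDensity_absolutelyContinuous _ _).ae_le (ae_injective_pi lam h0 m)
  have hleft : ∫⁻ ξ, ∑' α : {α : FiniteConfiguration E // α.1.carrier ⊆ ξ.carrier},
      (f α.1 : ℝ≥0∞) ∂μ = factorialMoment μ n B := by
    simp_rw [hfcoe, tsum_subset_tsum_enumerations]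
    rw [← lintegral_factorialMoment μ hg, lintegral_indicator_one hB]
  rw [← hleft, hr f hf, sampleIntegral]
  simp_rw [lintegral_ofTuple_mul h0 hmeas hrρ hf]
  rw [tsum_eq_single n]
  · have hperm : ∀ σ : Equiv.Perm (Fin n),
        ∫⁻ x, B.indicator (1 : (Fin n → E) → ℝ≥0∞) (x ∘ σ) ∂densityMeasure lam ρ n =
          densityMeasure lam ρ n B := fun σ => by
      rw [← lintegral_indicator_one hB]
      conv_rhs => rw [← densityMeasure_map_perm lam hmeas hsymm n σ]
      exact (lintegral_map hg (measurePreserving_comp_perm lam σ).measurable).symm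
    rw [lintegral_congr_ae (g := fun x => ∑ σ : Equiv.Perm (Fin n),
      B.indicator (1 : (Fin n → E) → ℝ≥0∞) (x ∘ σ))]
    · rw [lintegral_finsetSum (f := fun (σ : Equiv.Perm (Fin n)) (x : Fin n → E) =>
        B.indicator (1 : (Fin n → E) → ℝ≥0∞) (x ∘ σ)) _ fun σ _ => hg.comp (measurePreserving_comp_perm lam σ).measurable]
      simp only [hperm, Finset.sum_const, Finset.card_univ, Fintype.card_perm, Fintype.card_fin,
        nsmul_eq_mul]
      rw [← mul_assoc, ENNReal.inv_mul_cancel (by exact_mod_cast n.factorial_ne_zero) (by simp),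
        one_mul]
    · filter_upwards [hae n] with x hx
      rw [hfcoe, tsum_enumerations_ofTuple hx]
  · intro m hmn
    rw [lintegral_congr_ae (g := 0), Pi.zero_def, lintegral_zero, mul_zero]
    filter_upwards [hae m] with x hx
    have := isEmpty_coe_sort.2 (enumerations_ofTuple_of_ne hmn.symm hx)
    rw [hfcoe]
    simp

/-- A symmetric family of measurable functions of tuples comes from a measurable function of
finite configurations. -/
theorem exists_measurable_eq_ofTuple {ρ : (n : ℕ) → (Fin n → E) → ℝ≥0}
    (hmeas : ∀ k, Measurable (ρ k))
    (hsymm : ∀ (k : ℕ) (σ : Equiv.Perm (Fin k)) (x : Fin k → E), ρ k (x ∘ σ) = ρ k x) :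
    ∃ r : FiniteConfiguration E → ℝ≥0, Measurable r ∧
      ∀ (n : ℕ) (x : Fin n → E), Injective x → r (ofTuple x) = ρ n x := by
  refine ⟨fun α => (∑' n : ℕ, ((n.factorial : ℝ≥0∞))⁻¹ *
    ∑' y : α.enumerations n, (ρ n y : ℝ≥0∞)).toNNReal, ?_, fun n x hx => ?_⟩
  · exact (Measurable.tsum fun n => (measurable_tsum_enumerations
      (hmeas n).coe_nnreal_ennreal).const_mul _).ennreal_toNNReal
  · simp only
    rw [tsum_tsum_enumerations hx (fun n y => (ρ n y : ℝ≥0∞)) fun σ => by rw [hsymm],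
      ENNReal.toNNReal_coe]

/-- The product of counts also counts tuples with repetitions. This is how moment bounds yield
finiteness on compact boxes. -/
theorem factorialMoment_pi_le (μ : Measure (Configuration E)) {n : ℕ} {A : Fin n → Set E}
    (hA : ∀ i, MeasurableSet (A i)) :
    factorialMoment μ n (univ.pi A) ≤ ∫⁻ ξ, ∏ i, ((ξ.count (A i) : ℕ∞) : ℝ≥0∞) ∂μ := by
  have hB := MeasurableSet.univ_pi hA
  rw [← lintegral_indicator_one hB, lintegral_factorialMoment μ (measurable_one.indicator hB)]
  refine lintegral_mono fun ξ => ?_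
  simp_rw [← Configuration.integral_indicator_one, Configuration.integral]
  rw [ENNReal.prod_tsum_eq_tsum_pi fun i (a : ξ.carrier) =>
    (((A i).indicator (1 : E → ℝ≥0) a : ℝ≥0) : ℝ≥0∞)]
  have hinj : Injective fun (x : ξ.tuples n) (i : Fin n) => (⟨x.1 i, x.2.2 i⟩ : ξ.carrier) :=
    fun x y h => Subtype.ext (funext fun i => congrArg Subtype.val (congrFun h i))
  refine le_trans (ENNReal.tsum_le_tsum fun x => ?_)
    (ENNReal.tsum_comp_le_tsum_of_injective hinj _)
  by_cases hx : x.1 ∈ univ.pi A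
  · have : ∀ i, x.1 i ∈ A i := fun i => hx i trivial
    simp [indicator_of_mem, this, hx]
  · simp [hx]

theorem MomentFormula.factorialMoment_eq {μ : Measure (Configuration E)} [IsFiniteMeasure μ]
    {lam : Measure E} [SigmaFinite lam] {ρ : (n : ℕ) → (Fin n → E) → ℝ≥0}
    (h : MomentFormula μ lam ρ) (hmeas : ∀ k, Measurable (ρ k))
    (hsymm : ∀ (k : ℕ) (σ : Equiv.Perm (Fin k)) (x : Fin k → E), ρ k (x ∘ σ) = ρ k x)
    (hdiag : ∀ k, ∀ᵐ x ∂(Measure.pi fun _ : Fin k => lam), ¬ Injective x → ρ k x = 0)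
    (hfin : ∀ (n : ℕ) (K : Set E), IsCompact K →
      ∫⁻ ξ, ((ξ.count K : ℕ∞) : ℝ≥0∞) ^ n ∂μ < ∞) (n : ℕ) :
    factorialMoment μ n = densityMeasure lam ρ n := by
  obtain ⟨K, hK, hmono, -, hμ⟩ := exists_compact_exhaustion lam μ
  have hS : MeasurableSet (⋃ n, K n) := MeasurableSet.iUnion fun n => (hK n).measurableSet
  have hV : ∀ m, MeasurableSet (K m ∪ (⋃ n, K n)ᶜ) := fun m => (hK m).measurableSet.union hS.compl
  -- The compact sets cover only almost everything. Adding the complement of their union gives boxes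
  -- that cover all of `E^n`, without changing their factorial moment measure.
  refine Measure.ext_of_generateFrom_of_iUnion _
    (fun m => univ.pi fun _ : Fin n => K m ∪ (⋃ n, K n)ᶜ) generateFrom_pi.symm isPiSystem_pi
    ?_ ?_ ?_ ?_
  · refine eq_univ_of_forall fun x => mem_iUnion.2 ?_
    have hex : ∀ i, ∃ m, x i ∈ K m ∪ (⋃ n, K n)ᶜ := fun i => by
      by_cases hx : x i ∈ ⋃ n, K n
      · obtain ⟨m, hm⟩ := mem_iUnion.1 hx
        exact ⟨m, Or.inl hm⟩
      · exact ⟨0, Or.inr hx⟩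
    choose m hm using hex
    exact ⟨Finset.univ.sup m, fun i _ => union_subset_union_left _
      (hmono (Finset.le_sup (Finset.mem_univ i))) (hm i)⟩
  · exact fun m => mem_image_of_mem _ fun i _ => hV m
  · intro m
    refine ne_of_lt (lt_of_le_of_lt ((measure_mono_ae ?_).trans
      (factorialMoment_pi_le μ fun _ : Fin n => (hK m).measurableSet)) ?_)
    · filter_upwards [factorialMoment_ae hS hμ n] with x hx hxm i hi
      exact (hxm i hi).resolve_right fun hc => hc (hx.2 i)
    · simpa using hfin n (K m) (hK m)
  · rintro _ ⟨A, hA, rfl⟩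
    exact (h.hasCorrelationFunctions hmeas hsymm).measure_pi_eq hmeas hdiag n A
      fun i => hA i trivial

end Sample

theorem proposition3p6 {E : Type*} [TopologicalSpace E] [PolishSpace E] [MeasurableSpace E]
    [BorelSpace E] (lam : Measure E) [IsLocallyFiniteMeasure lam]
    (μ : Measure (Configuration E)) [IsProbabilityMeasure μ]
    (ρ : (k : ℕ) → (Fin k → E) → ℝ≥0)
    (hmeas : ∀ k, Measurable (ρ k))
    (hsymm : ∀ (k : ℕ) (σ : Equiv.Perm (Fin k)) (x : Fin k → E), ρ k (x ∘ σ) = ρ k x)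
    (hdiag : ∀ k, ∀ᵐ x ∂(Measure.pi fun _ : Fin k => lam), ¬ Function.Injective x → ρ k x = 0) :
    (HasCorrelationFunctions μ lam ρ ↔ MomentFormula μ lam ρ) ∧
    ((∀ x : E, lam {x} = 0) →
      (HasSampleCorrelationFunctions μ lam ρ → MomentFormula μ lam ρ) ∧
      ((∀ (n : ℕ) (K : Set E), IsCompact K →
          ∫⁻ ξ, ((ξ.count K : ℕ∞) : ℝ≥0∞) ^ n ∂μ < ∞) →
        MomentFormula μ lam ρ → HasSampleCorrelationFunctions μ lam ρ)) := by
  refine ⟨⟨fun h => momentFormula_of_measure_pi_eq hmeas (h.measure_pi_eq hmeas hdiag),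
    fun h => h.hasCorrelationFunctions hmeas hsymm⟩, fun h0 => ⟨fun h => ?_, fun hfin h => ?_⟩⟩
  · exact momentFormula_of_measure_pi_eq hmeas fun n A _ => by
      rw [h.factorialMoment_eq h0 hmeas hsymm n]
  · obtain ⟨r, hr, hrρ⟩ := exists_measurable_eq_ofTuple hmeas hsymm
    refine ⟨r, ⟨hr, fun f hf => ?_⟩, hrρ⟩
    rw [lintegral_tsum_subset μ hf, sampleIntegral]
    simp_rw [lintegral_ofTuple_mul h0 hmeas hrρ hf,
      h.factorialMoment_eq hmeas hsymm hdiag hfin]
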